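/- Let $\alpha,\mu$ be positive integers and let $\nu,\rho,\Omega_s,\Omega_w>0$ be real. For $i\in\{s,w\}$ let $h_i$ be the complex fading coefficient of user $U_i$, and assume that its channel gain $g_i=|h_i|^2$ follows the $\alpha$-$\mu$ fading law, that is, $g_i$ has probability density $$f_{g_i}(x)=\frac{\alpha\,\mu^{\mu}\,x^{\alpha\mu/2-1}}{2\,\Omega_i^{\alpha\mu}\,\Gamma(\mu)}\exp\!\left(-\frac{\mu\,x^{\alpha/2}}{\Omega_i^{\alpha}}\right)\quad(x>0),\qquad f_{g_i}(x)=0\quad(x\le 0).$$ In time-division orthogonal multiple access (OMA) with SNR $\rho$ and normalized delay exponent $\nu$, the effective rate of user $U_i$ is $$R_{i,\mathrm{OMA}}=-\frac1\nu\log_2\mathbb E\!\left[(1+\rho g_i)^{-\nu/2}\right],$$ and the sum effective rate is $R_{\mathrm{sum,OMA}}=R_{s,\mathrm{OMA}}+R_{w,\mathrm{OMA}}$. For a positive integer $x$ and real $y$ write $\Delta(x,y)$ for the list $\frac yx,\frac{y+1}x,\dots,\frac{y+x-1}x$. Meijer's G-function is $$G^{m,n}_{p,q}\!\left[z\,\middle|\,{a_1,\dots,a_p\atop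 b_1,\dots,b_q}\right]=\frac1{2\pi\mathrm i}\int_{c-\mathrm i\infty}^{c+\mathrm i\infty}\frac{\prod_{j=1}^m\Gamma(b_j-t)\,\prod_{j=1}^n\Gamma(1-a_j+t)}{\prod_{j=m+1}^q\Gamma(1-b_j+t)\,\prod_{j=n+1}^p\Gamma(a_j-t)}\,z^{t}\,dt,$$ where the line $\operatorname{Re}t=c$ has the poles of all $\Gamma(b_j-t)$, $j\le m$, on its right and those of all $\Gamma(1-a_j+t)$, $j\le n$, on its left. Then, for $i\in\{s,w\}$, the expectation above is finite and $$R_{i,\mathrm{OMA}}=-\frac1\nu\log_2\left[\frac{\alpha^{\nu/2}\,\mu^{\mu}\;G^{2+\alpha,\,\alpha}_{\alpha,\,2+\alpha}\!\left[\dfrac{\mu^2}{4\rho^{\alpha}\Omega_i^{2\alpha}}\,\middle|\,{\Delta(\alpha,\,1-\frac{\alpha\mu}2)\atop \Delta(2,0),\ \Delta(\alpha,\,\frac\nu2-\frac{\alpha\mu}2)}\right]}{\sqrt2\,(2\pi)^{\alpha-1/2}\,\Omega_i^{\alpha\mu}\,\Gamma(\mu)\,\Gamma(\frac\nu2)\,\rho^{\alpha\mu/2}}\right],$$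 so that the expression for $R_{w,\mathrm{OMA}}$ is the one for $R_{s,\mathrm{OMA}}$ with $\Omega_s$ replaced by $\Omega_w$, and $R_{\mathrm{sum,OMA}}$ is the sum of these two expressions. Here the G-function value is well defined (a separating line exists, and the integral converges absolutely with the same value along every separating line) and real, and the quantity inside the logarithm is positive. -/

import Mathlib

open MeasureTheory ProbabilityTheory

noncomputable section

/-! ### Meijer's G-function -/

/-- The integrand of the Mellin-Barnes integral of `G^{m,n}_{p,q}[z | a; b]`. Indices `j : Fin p` with
`j < n` are the first `n` upper parameters, and indices `j : Fin q` with `j < m` are the first `m`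
lower parameters. -/
def meijerIntegrand (m n : ℕ) {p q : ℕ} (a : Fin p → ℂ) (b : Fin q → ℂ) (z s : ℂ) : ℂ :=
  ((∏ j with j.val < m, Complex.Gamma (b j - s)) * (∏ j with j.val < n, Complex.Gamma (1 - a j + s))) /
    ((∏ j with m ≤ j.val, Complex.Gamma (1 - b j + s)) * (∏ j with n ≤ j.val, Complex.Gamma (a j - s)))
    * z ^ s

/-- The vertical line `Re s = c` separates the poles `b j + k` (`k = 0, 1, …`) of the factors
`Γ(b j - s)`, `j < m`, which lie to its right, from the poles `a j - 1 - k` of the factors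
`Γ(1 - a j + s)`, `j < n`, which lie to its left. -/
def MeijerSeparates (m n : ℕ) {p q : ℕ} (a : Fin p → ℂ) (b : Fin q → ℂ) (c : ℝ) : Prop :=
  (∀ j, j.val < m → ∀ k : ℕ, c < (b j + k).re) ∧ (∀ j, j.val < n → ∀ k : ℕ, (a j - 1 - k).re < c)

/-- `(1 / 2πi) ∫ F(s) ds` along the upward line `Re s = c`, with `F` the Mellin-Barnes integrand;
the line is parametrised by `s = c + i y`, so `ds = i dy`. -/
def meijerLineIntegral (m n : ℕ) {p q : ℕ} (a : Fin p → ℂ) (b : Fin q → ℂ) (z : ℂ) (c : ℝ) : ℂ :=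
  1 / (2 * Real.pi * Complex.I) *
    ∫ y : ℝ, meijerIntegrand m n a b z (c + y * Complex.I) * Complex.I

open Classical in
/-- Meijer's G-function `G^{m,n}_{p,q}[z | a; b]`, for parameters whose two families of poles can be
separated by a vertical line: the Mellin-Barnes integral along such a line (`0` if there is none). -/
def meijerG (m n : ℕ) {p q : ℕ} (a : Fin p → ℂ) (b : Fin q → ℂ) (z : ℂ) : ℂ :=
  if h : ∃ c : ℝ, MeijerSeparates m n a b c then meijerLineIntegral m n a b z h.choose else 0

/-- The G-function is well defined at these arguments: a separating vertical line exists, and the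
Mellin-Barnes integral converges absolutely, with the same value, along every such line. -/
def MeijerGWellDefined (m n : ℕ) {p q : ℕ} (a : Fin p → ℂ) (b : Fin q → ℂ) (z : ℂ) : Prop :=
  (∃ c : ℝ, MeijerSeparates m n a b c) ∧
    ∀ c : ℝ, MeijerSeparates m n a b c →
      Integrable (fun y : ℝ => meijerIntegrand m n a b z (c + y * Complex.I)) ∧
        meijerLineIntegral m n a b z c = meijerG m n a b z

/-- The list `Δ(x, y) = y/x, (y+1)/x, …, (y+x-1)/x`. -/
def paramDelta (x : ℕ) (y : ℝ) : Fin x → ℂ := fun k => (((y + (k.val : ℝ)) / (x : ℝ) : ℝ) : ℂ)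

/-! ### The α-μ fading channel and the effective rate of OMA -/

/-- The density of the channel gain `g = |h|²` of an α-μ fading link. -/
def gainPDF (α μ : ℕ) (Ω x : ℝ) : ℝ :=
  if 0 < x then
    (α * (μ : ℝ) ^ μ * x ^ ((α * μ : ℝ) / 2 - 1)) / (2 * Ω ^ (α * μ) * Real.Gamma μ)
      * Real.exp (-(μ * x ^ ((α : ℝ) / 2) / Ω ^ α))
  else 0

/-- The law of the channel gain of an α-μ fading link. -/
def gainLaw (α μ : ℕ) (Ω : ℝ) : Measure ℝ :=
  volume.withDensity fun x => ENNReal.ofReal (gainPDF α μ Ω x)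

/-- The channel gain `g = |h|²`. -/
def gain {S : Type*} (h : S → ℂ) : S → ℝ := fun ω => ‖h ω‖ ^ 2

/-- The OMA effective rate `-(1/ν) log₂ E[(1 + ρ g)^(-ν/2)]` of a user with fading coefficient `h`. -/
def omaRate {S : Type*} [MeasurableSpace S] (P : Measure S) (ν ρ : ℝ) (h : S → ℂ) : ℝ :=
  -(1 / ν) * Real.logb 2 (∫ ω, (1 + ρ * gain h ω) ^ (-(ν / 2)) ∂P)

/-- The OMA sum effective rate of the two users. -/
def omaSumRate {S : Type*} [MeasurableSpace S] (P : Measure S) (ν ρ : ℝ) (hs hw : S → ℂ) : ℝ :=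
  omaRate P ν ρ hs + omaRate P ν ρ hw

/-- Upper parameters `χ = Δ(α, 1 - αμ/2)`. -/
def upperParams (α μ : ℕ) : Fin α → ℂ := paramDelta α (1 - (α * μ : ℝ) / 2)

/-- Lower parameters `Δ(2, 0), Δ(α, ν/2 - αμ/2)`. -/
def lowerParams (α μ : ℕ) (ν : ℝ) : Fin (2 + α) → ℂ :=
  Fin.append (paramDelta 2 0) (paramDelta α (ν / 2 - (α * μ : ℝ) / 2))

/-- The argument `μ² / (4 ρ^α Ω^(2α))` of the G-function. -/
def gArg (α μ : ℕ) (ρ Ω : ℝ) : ℝ := (μ : ℝ) ^ 2 / (4 * ρ ^ α * Ω ^ (2 * α))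

/-- The value `G^{2+α,α}_{α,2+α}[μ² / (4 ρ^α Ω^(2α)) | χ; Δ(2,0), Δ(α, ν/2 - αμ/2)]`. -/
def omaG (α μ : ℕ) (ν ρ Ω : ℝ) : ℂ :=
  meijerG (2 + α) α (upperParams α μ) (lowerParams α μ ν) (gArg α μ ρ Ω)

/-- The quantity inside the logarithm of the closed form. -/
def omaClosedArg (α μ : ℕ) (ν ρ Ω : ℝ) : ℝ :=
  ((α : ℝ) ^ (ν / 2) * (μ : ℝ) ^ μ * (omaG α μ ν ρ Ω).re) /
    (√2 * (2 * Real.pi) ^ ((α : ℝ) - 1 / 2) * Ω ^ (α * μ) * Real.Gamma μ * Real.Gamma (ν / 2)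
      * ρ ^ ((α * μ : ℝ) / 2))

/-- The closed form of the OMA effective rate. -/
def omaClosedForm (α μ : ℕ) (ν ρ Ω : ℝ) : ℝ := -(1 / ν) * Real.logb 2 (omaClosedArg α μ ν ρ Ω)

/-- The closed form is meaningful: the G-function in it is well defined and real, and the logarithm
is taken of a positive number. -/
def OmaClosedFormMeaningful (α μ : ℕ) (ν ρ Ω : ℝ) : Prop :=
  MeijerGWellDefined (2 + α) α (upperParams α μ) (lowerParams α μ ν) (gArg α μ ρ Ω) ∧
    (omaG α μ ν ρ Ω).im = 0 ∧ 0 < omaClosedArg α μ ν ρ Ω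

end

/-! ### Gauss's multiplication formula for the Gamma function -/

/-! Both sides reduce to the real integral `omaIntegral`, J = ∫₀^∞ u^(a-1) (1+u)^(-r) exp(-w u^κ)
du, with a = αμ/2, r = ν/2, κ = α/2 and w = μ/(Ω^α ρ^(α/2)). For the expectation this is the
substitution u = ρx in the density (`integral_gainPDF_mul_rpow`).

For the G-function, Gauss's multiplication formula (`Complex.prod_Gamma_add_div`) merges each list
Δ(α, ·) into one Gamma factor, and Legendre duplication merges Δ(2, 0) into Γ(-2s). The powers of α
become constant in s, and the powers of 2 turn z^s into w^(2s). With t = -2s the integrand is a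
constant times Γ(t) w^(-t) Γ(a-κt) Γ(r-a+κt) (`meijerIntegrand_oma`).

By the beta integral the last two factors are Γ(r) ∫ u^(a-κt-1) (1+u)^(-r) du. After Fubini, the
integral over t is the Cahen-Mellin formula for exp(-w u^κ), which leaves Γ(r) J
(`Complex.integral_mellinBarnes`). This value does not depend on the separating line, so no contour
is shifted. Positivity of the logarithm's argument is inherited from the expectation. -/

theorem prod_range_mul_eq_prod_prod {M : Type*} [CommMonoid M] (f : ℕ → M) (m n : ℕ) :
    ∏ l ∈ Finset.range (m * n), f l =
      ∏ k ∈ Finset.range m, ∏ j ∈ Finset.range n, f (k + m * j) := by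
  induction n with
  | zero => simp
  | succ n ih =>
    rw [Nat.mul_succ, Finset.prod_range_add, ih, ← Finset.prod_mul_distrib]
    refine Finset.prod_congr rfl fun k _ => ?_
    rw [Finset.prod_range_succ, add_comm (m * n)]

/-- With m = p + 1, divide the m-th power of Stirling's sequence at M by its value at mM: the
factors (M/e)^(mM) cancel, and both sequences tend to √π. -/
theorem tendsto_factorial_pow_div (p : ℕ) :
    Filter.Tendsto (fun M : ℕ => (M.factorial : ℝ) ^ (p + 1) * ((p + 1 : ℕ) : ℝ) ^ ((p + 1) * M + 1) /
      (√M ^ p * ((p + 1) * M).factorial)) Filter.atTop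
      (nhds (√(2 * Real.pi) ^ p * √((p + 1 : ℕ) : ℝ))) := by
  have hS := Stirling.tendsto_stirlingSeq_sqrt_pi
  have hS' : Filter.Tendsto (fun M : ℕ => Stirling.stirlingSeq ((p + 1) * M)) Filter.atTop
      (nhds (√Real.pi)) :=
    hS.comp (Filter.tendsto_id.const_mul_atTop' (Nat.succ_pos p))
  have hpi : √Real.pi ≠ 0 := (Real.sqrt_pos.2 Real.pi_pos).ne'
  have key := ((hS.pow (p + 1)).div hS' hpi).mul_const (√2 ^ p * √((p + 1 : ℕ) : ℝ))
  have hlim : √Real.pi ^ (p + 1) / √Real.pi * (√2 ^ p * √((p + 1 : ℕ) : ℝ)) =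
      √(2 * Real.pi) ^ p * √((p + 1 : ℕ) : ℝ) := by
    rw [Real.sqrt_mul (by norm_num), mul_pow, pow_succ]
    field_simp
  rw [hlim] at key
  refine key.congr' ?_
  filter_upwards [Filter.eventually_gt_atTop 0] with M hM
  have hM' : (0 : ℝ) < M := by exact_mod_cast hM
  have hm' : (0 : ℝ) < ((p + 1 : ℕ) : ℝ) := by positivity
  simp only [Pi.div_apply, Stirling.stirlingSeq]
  generalize hmm : ((p + 1 : ℕ) : ℝ) = m at *
  have e1 : (((p + 1) * M : ℕ) : ℝ) = m * M := by rw [Nat.cast_mul, hmm]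
  rw [e1]
  have hF : (0 : ℝ) < ((p + 1) * M).factorial := by positivity
  have hG : (0 : ℝ) < M.factorial := by positivity
  have hq : (m * M / Real.exp 1) ^ ((p + 1) * M) =
      m ^ ((p + 1) * M) * (((M : ℝ) / Real.exp 1) ^ M) ^ (p + 1) := by
    rw [mul_div_assoc, mul_pow, ← pow_mul, mul_comm M]
  have hq0 : 0 < ((M : ℝ) / Real.exp 1) ^ M := by positivity
  have hz : √m ^ 2 = m := Real.sq_sqrt hm'.le
  have hz0 : 0 < √m := Real.sqrt_pos.2 hm'
  have hx0 : 0 < √(2 : ℝ) := Real.sqrt_pos.2 (by norm_num)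
  have hy0 : 0 < √(M : ℝ) := Real.sqrt_pos.2 hM'
  have hT0 : 0 < m ^ ((p + 1) * M) := by positivity
  rw [Real.sqrt_mul (by norm_num) (m * M : ℝ), Real.sqrt_mul hm'.le,
    Real.sqrt_mul (by norm_num) (M : ℝ), hq, pow_succ m]
  generalize ((M : ℝ) / Real.exp 1) ^ M = q at *
  generalize m ^ ((p + 1) * M) = T at *
  generalize √m = z at *
  generalize √(M : ℝ) = y at *
  generalize √(2 : ℝ) = x at *
  rw [← hz, div_pow, mul_pow, mul_pow]
  field_simp
  ring

/-- This is the constant of `Complex.prod_GammaSeq_add_div`. It is the preceding sequence at M = n +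
1 times √(n/(n+1))^p, which tends to 1. -/
theorem tendsto_gaussMultiplication_const (p : ℕ) :
    Filter.Tendsto (fun n : ℕ => √n ^ p * (n.factorial : ℝ) ^ (p + 1) *
      ((p + 1 : ℕ) : ℝ) ^ ((p + 1) * (n + 1)) / ((p + 1) * n + p).factorial) Filter.atTop
      (nhds (√(2 * Real.pi) ^ p * √((p + 1 : ℕ) : ℝ))) := by
  have h1 := (tendsto_factorial_pow_div p).comp (Filter.tendsto_add_atTop_nat 1)
  have h2 : Filter.Tendsto (fun n : ℕ => √((n : ℝ) / (n + 1)) ^ p) Filter.atTop (nhds 1) := by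
    simpa using ((Real.continuous_sqrt.tendsto _).comp
      (tendsto_natCast_div_add_atTop (1 : ℝ))).pow p
  have h3 := h2.mul h1
  rw [one_mul] at h3
  refine h3.congr fun n => ?_
  simp only [Function.comp_apply]
  have hfac : ((p + 1) * (n + 1)).factorial = (p + 1) * (n + 1) * ((p + 1) * n + p).factorial := by
    rw [show (p + 1) * (n + 1) = ((p + 1) * n + p) + 1 by ring, Nat.factorial_succ]
  have hn : (0 : ℝ) < ((n + 1 : ℕ) : ℝ) := by positivity
  have hm : (0 : ℝ) < ((p + 1 : ℕ) : ℝ) := by positivity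
  have hy : √((n + 1 : ℕ) : ℝ) ^ 2 = ((n + 1 : ℕ) : ℝ) := Real.sq_sqrt hn.le
  have hy0 : 0 < √((n + 1 : ℕ) : ℝ) := Real.sqrt_pos.2 hn
  rw [hfac, Nat.factorial_succ, Real.sqrt_div (Nat.cast_nonneg n), ← Nat.cast_succ]
  simp only [Nat.succ_eq_add_one]
  rw [Nat.cast_mul, Nat.cast_mul (_ * _), Nat.cast_mul (p + 1)]
  have hF : (0 : ℝ) < ((p + 1) * n + p).factorial := by positivity
  generalize ((p + 1 : ℕ) : ℝ) = m at *
  generalize √((n + 1 : ℕ) : ℝ) = y at *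
  rw [← hy, div_pow, mul_pow, pow_succ m, ← pow_mul]
  generalize m ^ ((p + 1) * (n + 1)) = T at *
  field_simp
  ring

namespace Complex

theorem prod_cpow_eq_cpow_sum {ι : Type*} (t : Finset ι) (f : ι → ℂ) {x : ℂ} (hx : x ≠ 0) :
    ∏ i ∈ t, x ^ f i = x ^ ∑ i ∈ t, f i := by
  simp_rw [cpow_def_of_ne_zero hx, Finset.mul_sum, exp_sum]

/-- Euler's approximants satisfy the multiplication formula up to explicit factors already at finite
n: the linear factors s + k + (p+1)j, sorted by residue k, fill one product of (p+1)(n+1)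
consecutive terms, which is the denominator of `GammaSeq s` at (p+1)n + p. -/
theorem prod_GammaSeq_add_div (p n : ℕ) (hn : n ≠ 0) (s : ℂ) :
    ∏ k ∈ Finset.range (p + 1), GammaSeq ((s + k) / (p + 1 : ℕ)) n =
      ((√n ^ p * (n.factorial : ℝ) ^ (p + 1) *
        ((p + 1 : ℕ) : ℝ) ^ ((p + 1) * (n + 1)) / ((p + 1) * n + p).factorial : ℝ) : ℂ) *
      (((n / ((p + 1) * n + p : ℕ) : ℝ) : ℂ) ^ s * GammaSeq s ((p + 1) * n + p)) := by
  have hm : ((p + 1 : ℕ) : ℂ) ≠ 0 := Nat.cast_ne_zero.2 p.succ_ne_zero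
  have hn' : (n : ℂ) ≠ 0 := Nat.cast_ne_zero.2 hn
  have hN : (((p + 1) * n + p : ℕ) : ℂ) ≠ 0 := Nat.cast_ne_zero.2 (by positivity)
  -- The exponents (s+k)/(p+1) add up to s + p/2.
  have hpow : ∏ k ∈ Finset.range (p + 1), (n : ℂ) ^ ((s + k) / (p + 1 : ℕ)) =
      (n : ℂ) ^ s * ((√n : ℝ) : ℂ) ^ p := by
    rw [prod_cpow_eq_cpow_sum _ _ hn', ← Finset.sum_div, Finset.sum_add_distrib, Real.sqrt_eq_rpow,
      ofReal_cpow (Nat.cast_nonneg n), ← cpow_nat_mul, ofReal_natCast, ← cpow_add _ _ hn']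
    congr 1
    have hg : (∑ k ∈ Finset.range (p + 1), (k : ℂ)) * 2 = (p + 1 : ℕ) * p := by
      have := Finset.sum_range_id_mul_two (p + 1)
      rw [Nat.add_sub_cancel] at this
      have := congrArg (Nat.cast : ℕ → ℂ) this
      rwa [Nat.cast_mul, Nat.cast_sum, Nat.cast_mul] at this
    have hg' : (∑ k ∈ Finset.range (p + 1), (k : ℂ)) = (p + 1 : ℕ) * p / 2 :=
      eq_div_of_mul_eq two_ne_zero hg
    rw [hg', Finset.sum_const, Finset.card_range, nsmul_eq_mul]
    push_cast at hm ⊢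
    field_simp
  have hprod : ∏ k ∈ Finset.range (p + 1), ∏ j ∈ Finset.range (n + 1), ((s + k) / (p + 1 : ℕ) + j) =
      (∏ l ∈ Finset.range ((p + 1) * n + p + 1), (s + l)) /
        ((p + 1 : ℕ) : ℂ) ^ ((p + 1) * (n + 1)) := by
    rw [show (p + 1) * n + p + 1 = (p + 1) * (n + 1) by ring, prod_range_mul_eq_prod_prod,
      eq_div_iff (pow_ne_zero _ hm), mul_comm (p + 1) (n + 1), pow_mul,
      ← Finset.card_range (p + 1), ← Finset.prod_const, Finset.card_range,
      ← Finset.prod_mul_distrib]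
    refine Finset.prod_congr rfl fun k _ => ?_
    rw [← Finset.card_range (n + 1), ← Finset.prod_const, Finset.card_range,
      ← Finset.prod_mul_distrib]
    refine Finset.prod_congr rfl fun j _ => ?_
    push_cast at hm ⊢
    field_simp
    ring
  have hdiv : (n : ℂ) ^ s = ((n / ((p + 1) * n + p : ℕ) : ℝ) : ℂ) ^ s *
      (((p + 1) * n + p : ℕ) : ℂ) ^ s := by
    rw [← ofReal_natCast ((p + 1) * n + p), ← mul_cpow_ofReal_nonneg (by positivity) (by positivity)]
    push_cast at hN ⊢
    rw [div_mul_cancel₀ _ hN]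
  simp only [GammaSeq]
  rw [Finset.prod_div_distrib, Finset.prod_mul_distrib, hpow, hprod, Finset.prod_const,
    Finset.card_range, hdiv]
  have hNs : (((p + 1) * n + p : ℕ) : ℂ) ^ s ≠ 0 := fun h => hN (cpow_eq_zero_iff _ _ |>.1 h).1
  have hF : ((((p + 1) * n + p).factorial : ℕ) : ℂ) ≠ 0 := Nat.cast_ne_zero.2 (Nat.factorial_ne_zero _)
  rw [ofReal_div _ (((p + 1) * n + p).factorial : ℝ), ofReal_mul, ofReal_mul, ofReal_pow, ofReal_pow,
    ofReal_pow]
  simp only [ofReal_natCast]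
  field_simp

/-- **Gauss's multiplication formula**. -/
theorem prod_Gamma_add_div (p : ℕ) (s : ℂ) :
    ∏ k ∈ Finset.range (p + 1), Gamma ((s + k) / (p + 1 : ℕ)) =
      ((√(2 * Real.pi) ^ p * √((p + 1 : ℕ) : ℝ) : ℝ) : ℂ) * (((p + 1 : ℕ) : ℂ) ^ (-s) * Gamma s) := by
  have hL : Filter.Tendsto (fun n : ℕ => ∏ k ∈ Finset.range (p + 1),
      GammaSeq ((s + k) / (p + 1 : ℕ)) n) Filter.atTop
      (nhds (∏ k ∈ Finset.range (p + 1), Gamma ((s + k) / (p + 1 : ℕ)))) :=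
    tendsto_finsetProd _ fun k _ => GammaSeq_tendsto_Gamma _
  have hN : Filter.Tendsto (fun n : ℕ => (p + 1) * n + p) Filter.atTop Filter.atTop :=
    Filter.tendsto_atTop_mono (fun n => by simp only [id]; nlinarith) Filter.tendsto_id
  have hm : (0 : ℝ) < ((p + 1 : ℕ) : ℝ) := by positivity
  have hratio : Filter.Tendsto (fun n : ℕ => (n / ((p + 1) * n + p : ℕ) : ℝ)) Filter.atTop
      (nhds (((p + 1 : ℕ) : ℝ)⁻¹)) := by
    have h := (tendsto_natCast_div_add_atTop ((p : ℝ) / (p + 1 : ℕ))).const_mul (((p + 1 : ℕ) : ℝ)⁻¹)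
    rw [mul_one] at h
    refine h.congr fun n => ?_
    have h1 : (((p + 1) * n + p : ℕ) : ℝ) = (p + 1 : ℕ) * (n + (p : ℝ) / (p + 1 : ℕ)) := by
      rw [mul_add, mul_div_cancel₀ _ hm.ne', Nat.cast_add, Nat.cast_mul]
    rw [h1, ← div_eq_inv_mul, div_div, mul_comm]
  -- The mismatch between n^s and ((p+1)n+p)^s produces the factor (p+1)^(-s).
  have hratio' : Filter.Tendsto (fun n : ℕ => ((n / ((p + 1) * n + p : ℕ) : ℝ) : ℂ) ^ s)
      Filter.atTop (nhds (((p + 1 : ℕ) : ℂ) ^ (-s))) := by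
    have h := Filter.Tendsto.cpow (Filter.Tendsto.ofReal hratio) (tendsto_const_nhds (x := s)) ?_
    · convert! h using 2
      rw [ofReal_inv, ofReal_natCast, inv_cpow _ _ (by rw [natCast_arg]; exact Real.pi_pos.ne), cpow_neg]
    · exact ofReal_mem_slitPlane.2 (inv_pos.2 hm)
  have hR := (Filter.Tendsto.ofReal (tendsto_gaussMultiplication_const p)).mul
    (hratio'.mul ((GammaSeq_tendsto_Gamma s).comp hN))
  refine tendsto_nhds_unique hL (hR.congr' ?_)
  filter_upwards [Filter.eventually_ne_atTop 0] with n hn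
  exact (prod_GammaSeq_add_div p n hn s).symm

end Complex

/-! ### Decay of the Gamma function on vertical lines -/

namespace Complex

theorem norm_Gamma_le_Gamma_re {s : ℂ} (hs : 0 < s.re) : ‖Gamma s‖ ≤ Real.Gamma s.re := by
  rw [Gamma_eq_integral hs, Real.Gamma_eq_integral hs, GammaIntegral]
  refine (norm_integral_le_integral_norm _).trans_eq ?_
  refine setIntegral_congr_fun measurableSet_Ioi fun x hx => ?_
  simp only [norm_mul, norm_cpow_eq_rpow_re_of_pos hx, sub_re, one_re, norm_real, Real.norm_eq_abs,
    Real.abs_exp]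

theorem continuous_Gamma_vertical {σ : ℝ} (hσ : 0 < σ) (κ : ℝ) :
    Continuous fun y : ℝ => Gamma (σ + κ * y * I) := by
  refine continuous_iff_continuousAt.2 fun y => ?_
  have h : ContinuousAt Gamma (σ + κ * y * I) :=
    continuousAt_Gamma _ fun m hm => by
      have := congrArg re hm
      simp at this
      have hm' : (0 : ℝ) ≤ m := m.cast_nonneg
      linarith
  exact h.comp (f := fun y : ℝ => (σ + κ * y * I : ℂ)) (by fun_prop)

/-- Two steps of the functional equation give Γ(s+2) = (s+1) s Γ(s), where |Γ(s+2)| ≤ Γ(σ+2) and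
|s+1| ≥ |s|. Quadratic decay is all that integrability on the line requires. -/
theorem norm_Gamma_vertical_le {σ : ℝ} (hσ : 0 < σ) (y : ℝ) :
    ‖Gamma (σ + y * I)‖ ≤ Real.Gamma (σ + 2) * (σ ^ 2 + y ^ 2)⁻¹ := by
  set s : ℂ := σ + y * I with hs
  have hre : s.re = σ := by simp [hs]
  have h0 : s ≠ 0 := fun h => by rw [h] at hre; simp at hre; linarith
  have h1 : s + 1 ≠ 0 := fun h => by
    have := congrArg re h; rw [add_re, hre] at this; simp at this; linarith
  have hG : Gamma (s + 2) = (s + 1) * (s * Gamma s) := by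
    rw [show s + 2 = s + 1 + 1 by ring, Gamma_add_one _ h1, Gamma_add_one _ h0]
  have hle := norm_Gamma_le_Gamma_re (s := s + 2) (by rw [add_re, hre]; simp; linarith)
  rw [hG, norm_mul, norm_mul, add_re, hre, re_ofNat] at hle
  have hsq : ‖s‖ ^ 2 = σ ^ 2 + y ^ 2 := by
    rw [← normSq_eq_norm_sq, normSq_apply]; simp [hs]; ring
  have hle1 : ‖s‖ ≤ ‖s + 1‖ := by
    refine le_of_sq_le_sq ?_ (norm_nonneg _)
    rw [← normSq_eq_norm_sq, ← normSq_eq_norm_sq, normSq_apply, normSq_apply]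
    simp [hs]; nlinarith
  have hpos : 0 < σ ^ 2 + y ^ 2 := by positivity
  rw [← div_eq_mul_inv, le_div_iff₀ hpos, ← hsq]
  calc ‖Gamma s‖ * ‖s‖ ^ 2 = ‖s‖ * (‖s‖ * ‖Gamma s‖) := by ring
    _ ≤ ‖s + 1‖ * (‖s‖ * ‖Gamma s‖) := by gcongr
    _ ≤ _ := hle

theorem integrable_Gamma_vertical {σ : ℝ} (hσ : 0 < σ) :
    Integrable fun y : ℝ => Gamma (σ + y * I) := by
  have hc : Continuous fun y : ℝ => Gamma (σ + y * I) := by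
    simpa using continuous_Gamma_vertical hσ 1
  have hint : Integrable fun y : ℝ => Real.Gamma (σ + 2) * (σ ^ 2 + y ^ 2)⁻¹ := by
    refine Integrable.const_mul ?_ _
    have h := (integrable_inv_one_add_sq.comp_mul_left' (inv_pos.2 hσ).ne').const_mul ((σ ^ 2)⁻¹)
    refine h.congr (Filter.Eventually.of_forall fun y => ?_)
    field_simp
  exact hint.mono' hc.aestronglyMeasurable
    (Filter.Eventually.of_forall fun y => norm_Gamma_vertical_le hσ y)

/-- The Cahen-Mellin integral for the exponential function. -/
theorem integral_cpow_mul_Gamma_vertical {σ v : ℝ} (hσ : 0 < σ) (hv : 0 < v) :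
    1 / (2 * Real.pi : ℂ) * ∫ y : ℝ, (v : ℂ) ^ (-(σ + y * I)) * Gamma (σ + y * I) =
      Real.exp (-v) := by
  have hre : ∀ y : ℝ, 0 < ((σ : ℂ) + y * I).re := fun y => by simpa using hσ
  have hmel : ∀ y : ℝ, mellin (fun x : ℝ => (Real.exp (-x) : ℂ)) (σ + y * I) = Gamma (σ + y * I) := by
    intro y
    rw [Gamma_eq_integral (hre y), GammaIntegral_eq_mellin]
  have hconv : MellinConvergent (fun x : ℝ => (Real.exp (-x) : ℂ)) (σ : ℂ) := by
    have h := GammaIntegral_convergent (s := σ) (by simpa using hσ)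
    refine h.congr_fun (fun x _ => ?_) measurableSet_Ioi
    simp [mul_comm]
  have h := mellinInv_mellin_eq σ (fun x : ℝ => (Real.exp (-x) : ℂ)) hv hconv
    (by simpa only [VerticalIntegrable, hmel] using integrable_Gamma_vertical hσ)
    (by fun_prop)
  rw [← h, mellinInv]
  simp_rw [hmel, real_smul, smul_eq_mul]
  push_cast
  rfl

end Complex

/-! ### The beta integral over the half-line -/

theorem image_div_one_sub_Ioo : (fun x : ℝ => x / (1 - x)) '' Set.Ioo 0 1 = Set.Ioi 0 := by
  ext u
  constructor
  · rintro ⟨x, ⟨h0, h1⟩, rfl⟩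
    exact div_pos h0 (by linarith)
  · intro hu
    have hu' : 0 < u := hu
    refine ⟨u / (1 + u), ⟨by positivity, (div_lt_one (by positivity)).2 (by linarith)⟩, ?_⟩
    field_simp
    ring

theorem hasDerivWithinAt_div_one_sub {x : ℝ} (hx : x ∈ Set.Ioo (0 : ℝ) 1) :
    HasDerivWithinAt (fun x : ℝ => x / (1 - x)) ((1 - x)⁻¹ ^ 2) (Set.Ioo 0 1) x := by
  have h1 : 1 - x ≠ 0 := by linarith [hx.2]
  have h := (hasDerivAt_id x).div ((hasDerivAt_id x).const_sub 1) h1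
  convert! h.hasDerivWithinAt using 1
  simp only [id]
  field_simp
  ring

theorem injOn_div_one_sub : Set.InjOn (fun x : ℝ => x / (1 - x)) (Set.Ioo 0 1) := by
  intro x hx y hy h
  have h1 : 1 - x ≠ 0 := by linarith [hx.2]
  have h2 : 1 - y ≠ 0 := by linarith [hy.2]
  simp only at h
  rw [div_eq_div_iff h1 h2] at h
  linarith

/-- Under u = x/(1-x) one has 1 + u = (1-x)⁻¹ and du = (1-x)⁻² dx, so the powers of 1-x combine to
r-a-1 and the integrand becomes that of B(a, r-a). -/
theorem betaPrime_substitution (a r : ℂ) {x : ℝ} (hx : x ∈ Set.Ioo (0 : ℝ) 1) :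
    |(1 - x)⁻¹ ^ 2| • (((x / (1 - x) : ℝ) : ℂ) ^ (a - 1) * ((1 + x / (1 - x) : ℝ) : ℂ) ^ (-r)) =
      (x : ℂ) ^ (a - 1) * (1 - (x : ℂ)) ^ (r - a - 1) := by
  obtain ⟨h0, h1⟩ := hx
  have hy : 0 < 1 - x := by linarith
  have hyc : (((1 - x : ℝ)) : ℂ) ≠ 0 := Complex.ofReal_ne_zero.2 hy.ne'
  have e1 : 1 + x / (1 - x) = (1 - x)⁻¹ := by field_simp; ring
  have harg : (((1 - x : ℝ)) : ℂ).arg ≠ Real.pi := by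
    rw [Complex.arg_ofReal_of_nonneg hy.le]; exact Real.pi_pos.ne
  have e2 : ∀ z : ℂ, (((1 - x)⁻¹ : ℝ) : ℂ) ^ z = ((1 - x : ℝ) : ℂ) ^ (-z) := fun z => by
    rw [Complex.ofReal_inv, Complex.inv_cpow _ _ harg, Complex.cpow_neg]
  rw [e1, abs_of_pos (by positivity), div_eq_mul_inv x, Complex.ofReal_mul,
    Complex.mul_cpow_ofReal_nonneg h0.le (by positivity), e2, e2, Complex.real_smul,
    Complex.ofReal_pow, ← Complex.cpow_ofNat, e2, show (1 : ℂ) - x = ((1 - x : ℝ) : ℂ) by push_cast; rfl,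
    show r - a - 1 = -2 + (-(a - 1) + - -r) by ring, Complex.cpow_add _ _ hyc,
    Complex.cpow_add _ _ hyc]
  ring

theorem integrableOn_betaPrime {a r : ℂ} (ha : 0 < a.re) (hr : a.re < r.re) :
    IntegrableOn (fun u : ℝ => (u : ℂ) ^ (a - 1) * ((1 + u : ℝ) : ℂ) ^ (-r)) (Set.Ioi 0) := by
  rw [← image_div_one_sub_Ioo, integrableOn_image_iff_integrableOn_abs_deriv_smul measurableSet_Ioo
    (fun x hx => hasDerivWithinAt_div_one_sub hx) injOn_div_one_sub]
  have h := Complex.betaIntegral_convergent ha (v := r - a) (by simpa using hr)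
  rw [intervalIntegrable_iff_integrableOn_Ioo_of_le zero_le_one] at h
  exact h.congr_fun (fun x hx => (betaPrime_substitution a r hx).symm) measurableSet_Ioo

theorem integral_betaPrime {a r : ℂ} (ha : 0 < a.re) (hr : a.re < r.re) :
    ∫ u in Set.Ioi (0 : ℝ), (u : ℂ) ^ (a - 1) * ((1 + u : ℝ) : ℂ) ^ (-r) =
      Complex.Gamma a * Complex.Gamma (r - a) / Complex.Gamma r := by
  rw [← image_div_one_sub_Ioo, integral_image_eq_integral_abs_deriv_smul measurableSet_Ioo
    (fun x hx => hasDerivWithinAt_div_one_sub hx) injOn_div_one_sub,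
    setIntegral_congr_fun measurableSet_Ioo (fun x hx => betaPrime_substitution a r hx)]
  have h := Complex.betaIntegral_eq_Gamma_mul_div a (r - a) ha (by simpa using hr)
  rw [add_sub_cancel] at h
  rw [← h, Complex.betaIntegral, intervalIntegral.integral_of_le zero_le_one,
    integral_Ioc_eq_integral_Ioo]

/-! ### A Mellin-Barnes integral -/

namespace Complex

/-- The function of two variables whose iterated integrals are the two sides of the Mellin-Barnes
formula. -/
noncomputable def mellinBarnesKernel (a r κ w σ : ℝ) (y u : ℝ) : ℂ :=
  Gamma (σ + y * I) * ((w : ℂ) ^ (-(σ + y * I)) *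
    ((u : ℂ) ^ (a - κ * (σ + y * I) - 1) * ((1 + u : ℝ) : ℂ) ^ (-r : ℂ)))

/-- The integrand of the Mellin-Barnes formula on the vertical line of abscissa `σ`. -/
noncomputable def mellinBarnesIntegrand (a r κ w σ : ℝ) (y : ℝ) : ℂ :=
  Gamma (σ + y * I) * ((w : ℂ) ^ (-(σ + y * I)) *
    (Gamma (a - κ * (σ + y * I)) * Gamma (r - a + κ * (σ + y * I))))

variable {a r κ w σ : ℝ}

/-- The kernel is Γ(σ+iy), integrable in y, times u^(a-κσ-1) (1+u)^(-r), integrable in u, times a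
factor of constant modulus w^(-σ). -/
theorem integrable_mellinBarnesKernel (hσ : 0 < σ) (hw : 0 < w) (ha : 0 < a - κ * σ)
    (hr : a - κ * σ < r) :
    Integrable (Function.uncurry (mellinBarnesKernel a r κ w σ))
      (volume.prod (volume.restrict (Set.Ioi 0))) := by
  have h1 : IntegrableOn (fun u : ℝ => (u : ℂ) ^ ((a - κ * σ : ℝ) - 1 : ℂ) *
      ((1 + u : ℝ) : ℂ) ^ (-r : ℂ)) (Set.Ioi 0) :=
    integrableOn_betaPrime (by simpa using ha) (by simpa using hr)
  have h2 := (integrable_Gamma_vertical hσ).mul_prod h1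
  have hm : Measurable fun z : ℝ × ℝ => (w : ℂ) ^ (-(σ + z.1 * I)) * (z.2 : ℂ) ^ (-(κ * z.1) * I) := by
    fun_prop
  have hpos : ∀ᵐ z : ℝ × ℝ ∂(volume.prod (volume.restrict (Set.Ioi 0))), 0 < z.2 :=
    Measure.quasiMeasurePreserving_snd.ae (ae_restrict_mem measurableSet_Ioi)
  have h3 := h2.mul_bdd (c := w ^ (-σ)) hm.aestronglyMeasurable (by
    filter_upwards [hpos] with z hz
    rw [norm_mul, norm_cpow_eq_rpow_re_of_pos hw, norm_cpow_eq_rpow_re_of_pos hz]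
    simp)
  refine h3.congr ?_
  filter_upwards [hpos] with z hz
  have hz' : (z.2 : ℂ) ≠ 0 := ofReal_ne_zero.2 hz.ne'
  simp only [Function.uncurry, mellinBarnesKernel]
  rw [show (a - κ * (σ + z.1 * I) - 1 : ℂ) = ((a - κ * σ : ℝ) - 1 : ℂ) + (-(κ * z.1) * I) by
    push_cast; ring, cpow_add _ _ hz']
  ring

theorem integral_mellinBarnesKernel_right (ha : 0 < a - κ * σ)
    (hr : a - κ * σ < r) (y : ℝ) :
    ∫ u in Set.Ioi (0 : ℝ), mellinBarnesKernel a r κ w σ y u =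
      Gamma (σ + y * I) * ((w : ℂ) ^ (-(σ + y * I)) *
        (Gamma (a - κ * (σ + y * I)) * Gamma (r - a + κ * (σ + y * I)) / Gamma r)) := by
  simp only [mellinBarnesKernel]
  rw [integral_const_mul, integral_const_mul,
    integral_betaPrime (by simpa using ha) (by simpa using hr)]
  congr 5
  ring

/-- The powers of w and u carrying y combine to (w u^κ)^(-(σ+iy)), so the Cahen-Mellin integral
applies at v = w u^κ. -/
theorem integral_mellinBarnesKernel_left (hσ : 0 < σ) (hw : 0 < w) {u : ℝ} (hu : 0 < u) :
    1 / (2 * Real.pi : ℂ) * ∫ y : ℝ, mellinBarnesKernel a r κ w σ y u =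
      ((u ^ (a - 1) * (1 + u) ^ (-r) * Real.exp (-(w * u ^ κ)) : ℝ) : ℂ) := by
  have hu' : (u : ℂ) ≠ 0 := ofReal_ne_zero.2 hu.ne'
  have hk : ∀ y : ℝ, mellinBarnesKernel a r κ w σ y u =
      ((u ^ (a - 1) * (1 + u) ^ (-r) : ℝ) : ℂ) *
        (((w * u ^ κ : ℝ) : ℂ) ^ (-(σ + y * I)) * Gamma (σ + y * I)) := by
    intro y
    rw [mellinBarnesKernel, ofReal_mul w, mul_cpow_ofReal_nonneg hw.le (by positivity),
      ← cpow_mul_ofReal_nonneg hu.le,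
      show (a - κ * (σ + y * I) - 1 : ℂ) = (a - 1 : ℝ) + κ * (-(σ + y * I)) by push_cast; ring,
      cpow_add _ _ hu', ofReal_mul, ofReal_cpow hu.le, ofReal_cpow (by positivity)]
    push_cast
    ring
  simp_rw [hk]
  rw [integral_const_mul, mul_left_comm, integral_cpow_mul_Gamma_vertical hσ (by positivity),
    ← ofReal_mul]

/-- Up to the factor Γ(r), the integrand is the inner integral of a kernel integrable on the
product, so no decay estimate for the other two Gamma factors is needed. -/
theorem integrable_mellinBarnes (hσ : 0 < σ) (hw : 0 < w) (ha : 0 < a - κ * σ)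
    (hr : a - κ * σ < r) :
    Integrable (mellinBarnesIntegrand a r κ w σ) := by
  have hr0 : Gamma r ≠ 0 := Gamma_ne_zero_of_re_pos (by simpa using ha.trans hr)
  refine ((integrable_mellinBarnesKernel hσ hw ha hr).integral_prod_left.mul_const (Gamma r)).congr
    (Filter.Eventually.of_forall fun y => ?_)
  simp only [Function.uncurry]
  rw [integral_mellinBarnesKernel_right ha hr, mellinBarnesIntegrand]
  field_simp

theorem integral_mellinBarnes (hσ : 0 < σ) (hw : 0 < w) (ha : 0 < a - κ * σ)
    (hr : a - κ * σ < r) :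
    1 / (2 * Real.pi : ℂ) * ∫ y : ℝ, mellinBarnesIntegrand a r κ w σ y =
    ((Real.Gamma r * ∫ u in Set.Ioi (0 : ℝ),
      u ^ (a - 1) * (1 + u) ^ (-r) * Real.exp (-(w * u ^ κ)) : ℝ) : ℂ) := by
  have hr0 : Gamma r ≠ 0 := Gamma_ne_zero_of_re_pos (by simpa using ha.trans hr)
  have hswap := integral_integral_swap (integrable_mellinBarnesKernel hσ hw ha hr)
  have h1 : ∀ y : ℝ, mellinBarnesIntegrand a r κ w σ y = Gamma r * ∫ u in Set.Ioi (0 : ℝ), mellinBarnesKernel a r κ w σ y u := by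
    intro y
    rw [integral_mellinBarnesKernel_right ha hr, mellinBarnesIntegrand]
    field_simp
  simp_rw [h1]
  rw [integral_const_mul, hswap, mul_left_comm, ← integral_const_mul,
    setIntegral_congr_fun measurableSet_Ioi
      (fun u hu => integral_mellinBarnesKernel_left hσ hw hu), integral_complex_ofReal, ofReal_mul,
    Gamma_ofReal]

end Complex

/-! ### The G-function of the closed form -/

theorem Complex.prod_fin_Gamma_add_div {n : ℕ} (hn : 0 < n) (s : ℂ) :
    ∏ k : Fin n, Complex.Gamma ((s + (k.val : ℂ)) / n) =
      ((√(2 * Real.pi) ^ (n - 1) * √(n : ℝ) : ℝ) : ℂ) * ((n : ℂ) ^ (-s) * Complex.Gamma s) := by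
  obtain ⟨p, rfl⟩ := Nat.exists_eq_succ_of_ne_zero hn.ne'
  rw [Fin.prod_univ_eq_prod_range (fun k => Complex.Gamma ((s + (k : ℂ)) / (p.succ : ℕ)))]
  exact Complex.prod_Gamma_add_div p s

theorem prod_Gamma_one_sub_upperParams {α : ℕ} (hα : 0 < α) (μ : ℕ) (s : ℂ) :
    ∏ j, Complex.Gamma (1 - upperParams α μ j + s) =
      ((√(2 * Real.pi) ^ (α - 1) * √(α : ℝ) : ℝ) : ℂ) *
        ((α : ℂ) ^ (-(α * s + α * μ / 2)) * Complex.Gamma (α * s + α * μ / 2)) := by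
  -- Here 1 - a_j + s = (αs + αμ/2 + (α-1-j))/α, so the list of arguments is run through backwards.
  rw [← Complex.prod_fin_Gamma_add_div hα, ← Equiv.prod_comp Fin.revPerm]
  refine Finset.prod_congr rfl fun k _ => ?_
  have hα' : (α : ℂ) ≠ 0 := Nat.cast_ne_zero.2 hα.ne'
  congr 1
  simp only [upperParams, paramDelta, Fin.revPerm_apply, Fin.val_rev]
  rw [Nat.cast_sub (by have := k.isLt; lia)]
  push_cast
  field_simp
  ring

theorem prod_Gamma_lowerParams_sub {α : ℕ} (hα : 0 < α) (μ : ℕ) (ν : ℝ) (s : ℂ) :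
    ∏ j, Complex.Gamma (lowerParams α μ ν j - s) =
      Complex.Gamma (-2 * s) * 2 ^ (1 + 2 * s) * (√Real.pi : ℝ) *
        (((√(2 * Real.pi) ^ (α - 1) * √(α : ℝ) : ℝ) : ℂ) *
        ((α : ℂ) ^ (-(ν / 2 - α * μ / 2 - α * s)) * Complex.Gamma (ν / 2 - α * μ / 2 - α * s))) := by
  rw [← Complex.prod_fin_Gamma_add_div hα, Fin.prod_univ_add, Fin.prod_univ_two]
  have hα' : (α : ℂ) ≠ 0 := Nat.cast_ne_zero.2 hα.ne'
  simp only [lowerParams, Fin.append_left, Fin.append_right]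
  congr 1
  · have h := Complex.Gamma_mul_Gamma_add_half (-s)
    rw [show 2 * -s = -2 * s by ring, show 1 - -2 * s = 1 + 2 * s by ring] at h
    rw [← h]
    congr 2
    · simp [paramDelta]
    · simp [paramDelta]
      ring
  · refine Finset.prod_congr rfl fun k _ => ?_
    congr 1
    simp only [paramDelta]
    push_cast
    field_simp
    ring

/-- The constant that relates the G-function to the Mellin-Barnes integral with three Gamma
functions. -/
noncomputable def omaMeijerConst (α : ℕ) (ν : ℝ) : ℝ :=
  2 * √Real.pi * (2 * Real.pi) ^ (α - 1) * (α : ℝ) ^ (1 - ν / 2)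

/-- The square root of four times the argument of the G-function. -/
noncomputable def omaScale (α μ : ℕ) (ρ Ω : ℝ) : ℝ := μ / (Ω ^ α * ρ ^ ((α : ℝ) / 2))

theorem omaScale_pos {α μ : ℕ} (hμ : 0 < μ) {ρ Ω : ℝ} (hρ : 0 < ρ) (hΩ : 0 < Ω) :
    0 < omaScale α μ ρ Ω := by
  have : (0 : ℝ) < μ := Nat.cast_pos.2 hμ
  unfold omaScale
  positivity

theorem gArg_eq (α μ : ℕ) {ρ : ℝ} (hρ : 0 < ρ) (Ω : ℝ) :
    gArg α μ ρ Ω = (omaScale α μ ρ Ω / 2) * (omaScale α μ ρ Ω / 2) := by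
  have h : ρ ^ ((α : ℝ) / 2) * ρ ^ ((α : ℝ) / 2) = ρ ^ α := by
    rw [← Real.rpow_add hρ, add_halves, Real.rpow_natCast]
  rw [gArg, omaScale, ← h, mul_comm 2 α, pow_mul]
  field_simp
  norm_num

theorem gArg_cpow {α μ : ℕ} (hμ : 0 < μ) {ρ Ω : ℝ} (hρ : 0 < ρ) (hΩ : 0 < Ω) (s : ℂ) :
    2 ^ (2 * s) * (gArg α μ ρ Ω : ℂ) ^ s = (omaScale α μ ρ Ω : ℂ) ^ (2 * s) := by
  have hw := omaScale_pos (α := α) hμ hρ hΩ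
  have hw2 : 0 ≤ omaScale α μ ρ Ω / 2 := by positivity
  rw [gArg_eq α μ hρ, Complex.ofReal_mul, Complex.mul_cpow_ofReal_nonneg hw2 hw2]
  have h : (omaScale α μ ρ Ω : ℂ) = ((2 : ℝ) : ℂ) * ((omaScale α μ ρ Ω / 2 : ℝ) : ℂ) := by
    push_cast; ring
  have hne : ((omaScale α μ ρ Ω / 2 : ℝ) : ℂ) ≠ 0 := by
    rw [Complex.ofReal_ne_zero]; positivity
  rw [h, Complex.mul_cpow_ofReal_nonneg (by norm_num) hw2, two_mul s, Complex.cpow_add _ _ hne]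
  norm_num

theorem meijerIntegrand_oma {α μ : ℕ} (hα : 0 < α) (hμ : 0 < μ) (ν : ℝ) {ρ Ω : ℝ} (hρ : 0 < ρ)
    (hΩ : 0 < Ω) (s : ℂ) :
    meijerIntegrand (2 + α) α (upperParams α μ) (lowerParams α μ ν) (gArg α μ ρ Ω) s =
      omaMeijerConst α ν * (Complex.Gamma (-2 * s) * ((omaScale α μ ρ Ω : ℂ) ^ (-(-2 * s)) *
        (Complex.Gamma (α * s + α * μ / 2) * Complex.Gamma (ν / 2 - α * μ / 2 - α * s)))) := by
  have h1 : (Finset.univ.filter fun j : Fin (2 + α) => j.val < 2 + α) = Finset.univ :=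
    Finset.filter_true_of_mem fun j _ => j.isLt
  have h2 : (Finset.univ.filter fun j : Fin α => j.val < α) = Finset.univ :=
    Finset.filter_true_of_mem fun j _ => j.isLt
  have h3 : (Finset.univ.filter fun j : Fin (2 + α) => 2 + α ≤ j.val) = ∅ :=
    Finset.filter_false_of_mem fun j _ => not_le.2 j.isLt
  have h4 : (Finset.univ.filter fun j : Fin α => α ≤ j.val) = ∅ :=
    Finset.filter_false_of_mem fun j _ => not_le.2 j.isLt
  have hα' : (0 : ℝ) < α := Nat.cast_pos.2 hα
  have hαc : (α : ℂ) ≠ 0 := Nat.cast_ne_zero.2 hα.ne'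
  -- The exponents add up to -ν/2, so s drops out; the extra factor α is the product of the two √α
  -- from Gauss's formula.
  have hpow : (α : ℂ) ^ (-(ν / 2 - α * μ / 2 - α * s)) * (α : ℂ) ^ (-(α * s + α * μ / 2)) * α =
      (((α : ℝ) ^ (1 - ν / 2) : ℝ) : ℂ) := by
    rw [← Complex.cpow_add _ _ hαc, Complex.ofReal_cpow hα'.le, Complex.ofReal_natCast]
    have hmul : ∀ z : ℂ, (α : ℂ) ^ z * α = (α : ℂ) ^ (z + 1) := fun z => by
      rw [Complex.cpow_add _ _ hαc, Complex.cpow_one]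
    rw [hmul]
    congr 1
    push_cast
    ring
  have hsq : ((√(2 * Real.pi) ^ (α - 1) * √(α : ℝ) : ℝ) : ℂ) *
      ((√(2 * Real.pi) ^ (α - 1) * √(α : ℝ) : ℝ) : ℂ) = (((2 * Real.pi) ^ (α - 1) : ℝ) : ℂ) * α := by
    rw [← Complex.ofReal_mul, mul_mul_mul_comm, ← mul_pow, Real.mul_self_sqrt (by positivity),
      Real.mul_self_sqrt hα'.le, Complex.ofReal_mul, Complex.ofReal_natCast]
  rw [meijerIntegrand, h1, h2, h3, h4, Finset.prod_empty, Finset.prod_empty, mul_one, div_one,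
    prod_Gamma_one_sub_upperParams hα, prod_Gamma_lowerParams_sub hα, omaMeijerConst,
    show -(-2 * s) = 2 * s by ring, ← gArg_cpow hμ hρ hΩ s, Complex.cpow_add _ _ two_ne_zero,
    Complex.cpow_one, Complex.ofReal_mul (2 * √Real.pi * _), ← hpow, Complex.ofReal_mul (2 * √Real.pi),
    Complex.ofReal_mul 2, Complex.ofReal_ofNat]
  linear_combination (Complex.Gamma (-2 * s) * (2 * 2 ^ (2 * s)) * (√Real.pi : ℝ) *
    (α : ℂ) ^ (-(ν / 2 - α * μ / 2 - α * s)) * (α : ℂ) ^ (-(α * s + α * μ / 2)) *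
    Complex.Gamma (ν / 2 - α * μ / 2 - α * s) * Complex.Gamma (α * s + α * μ / 2) *
    (gArg α μ ρ Ω : ℂ) ^ s) * hsq

/-- Only the extreme poles bind: 0 and the first entry of Δ(α, ν/2 - αμ/2) on the right, and -μ/2,
from the last upper parameter, on the left. -/
theorem meijerSeparates_oma_iff {α : ℕ} (hα : 0 < α) (μ : ℕ) (ν c : ℝ) :
    MeijerSeparates (2 + α) α (upperParams α μ) (lowerParams α μ ν) c ↔
      c < 0 ∧ α * c < ν / 2 - α * μ / 2 ∧ -(α * μ / 2 : ℝ) < α * c := by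
  have hα' : (0 : ℝ) < α := Nat.cast_pos.2 hα
  constructor
  · rintro ⟨h1, h2⟩
    have ha := h1 (Fin.castAdd α 0) (by simp) 0
    have hb := h1 (Fin.natAdd 2 ⟨0, hα⟩) (by simp [hα]) 0
    have hc := h2 ⟨α - 1, by lia⟩ (by simp [hα]) 0
    rw [lowerParams, Fin.append_left] at ha
    rw [lowerParams, Fin.append_right] at hb
    simp only [paramDelta, upperParams, Nat.cast_zero, add_zero, sub_zero, Complex.ofReal_re,
      Complex.sub_re, Complex.one_re, Fin.val_zero, zero_div] at ha hb hc
    rw [Nat.cast_sub hα, Nat.cast_one] at hc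
    refine ⟨ha, ?_, ?_⟩
    · rw [lt_div_iff₀ hα'] at hb
      linarith
    · rw [sub_lt_iff_lt_add, div_lt_iff₀ hα'] at hc
      linarith
  · rintro ⟨h1, h2, h3⟩
    refine ⟨fun j _ k => ?_, fun j _ k => ?_⟩
    · have hk : (0 : ℝ) ≤ k := k.cast_nonneg
      rw [lowerParams, Complex.add_re, Complex.natCast_re]
      refine Fin.addCases (fun i => ?_) (fun i => ?_) j
      · rw [Fin.append_left, paramDelta, Complex.ofReal_re]
        have : (0 : ℝ) ≤ (0 + (i.val : ℝ)) / (2 : ℕ) := by positivity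
        linarith
      · rw [Fin.append_right, paramDelta, Complex.ofReal_re]
        have hi : (0 : ℝ) ≤ i.val := i.val.cast_nonneg
        have : c < (ν / 2 - (α * μ : ℝ) / 2 + i.val) / α := by
          rw [lt_div_iff₀ hα']; linarith
        linarith
    · have hk : (0 : ℝ) ≤ k := k.cast_nonneg
      have hj : (j.val : ℝ) + 1 ≤ α := by exact_mod_cast j.isLt
      rw [upperParams, paramDelta, Complex.sub_re, Complex.sub_re, Complex.ofReal_re,
        Complex.one_re, Complex.natCast_re]
      have : (1 - (α * μ : ℝ) / 2 + j.val) / α < c + 1 := by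
        rw [div_lt_iff₀ hα']; linarith
      linarith

theorem exists_meijerSeparates_oma {α μ : ℕ} (hα : 0 < α) (hμ : 0 < μ) {ν : ℝ} (hν : 0 < ν) :
    ∃ c, MeijerSeparates (2 + α) α (upperParams α μ) (lowerParams α μ ν) c := by
  have hα' : (0 : ℝ) < α := Nat.cast_pos.2 hα
  have hμ' : (0 : ℝ) < μ := Nat.cast_pos.2 hμ
  have hpos : (0 : ℝ) < α * μ / 2 := by positivity
  -- Here d stands for αc; the strip is nonempty because αμ > 0 and ν > 0.
  obtain ⟨d, hd1, hd2⟩ := exists_between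
    (show -(α * μ / 2 : ℝ) < min 0 (ν / 2 - α * μ / 2) from
      lt_min (neg_lt_zero.2 hpos) (by linarith))
  refine ⟨d / α, (meijerSeparates_oma_iff hα μ ν _).2 ?_⟩
  rw [mul_div_cancel₀ _ hα'.ne']
  exact ⟨div_neg_of_neg_of_pos (hd2.trans_le (min_le_left _ _)) hα',
    hd2.trans_le (min_le_right _ _), hd1⟩

/-- The integral on the half-line to which the expectation and the G-function both reduce. -/
noncomputable def omaIntegral (α μ : ℕ) (ν ρ Ω : ℝ) : ℝ :=
  ∫ u in Set.Ioi (0 : ℝ), u ^ ((α * μ : ℝ) / 2 - 1) * (1 + u) ^ (-(ν / 2)) *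
    Real.exp (-(omaScale α μ ρ Ω * u ^ ((α : ℝ) / 2)))

section

variable {α μ : ℕ} {ν ρ Ω c : ℝ}

theorem meijerIntegrand_oma_line (hα : 0 < α) (hμ : 0 < μ) (hρ : 0 < ρ) (hΩ : 0 < Ω) (y : ℝ) :
    meijerIntegrand (2 + α) α (upperParams α μ) (lowerParams α μ ν) (gArg α μ ρ Ω)
        (c + y * Complex.I) =
      omaMeijerConst α ν * Complex.mellinBarnesIntegrand ((α * μ : ℝ) / 2) (ν / 2) ((α : ℝ) / 2)
        (omaScale α μ ρ Ω) (-2 * c) (-2 * y) := by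
  rw [meijerIntegrand_oma hα hμ ν hρ hΩ]
  have h1 : ((-2 * c : ℝ) + (-2 * y : ℝ) * Complex.I : ℂ) = -2 * (c + y * Complex.I) := by
    push_cast; ring
  simp only [Complex.mellinBarnesIntegrand, h1]
  congr 4
  · congr 1
    push_cast; ring
  · congr 1
    push_cast; ring

theorem integrable_meijerIntegrand_oma (hα : 0 < α) (hμ : 0 < μ) (hρ : 0 < ρ) (hΩ : 0 < Ω)
    (hc : MeijerSeparates (2 + α) α (upperParams α μ) (lowerParams α μ ν) c) :
    Integrable fun y : ℝ => meijerIntegrand (2 + α) α (upperParams α μ) (lowerParams α μ ν)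
      (gArg α μ ρ Ω) (c + y * Complex.I) := by
  obtain ⟨h1, h2, h3⟩ := (meijerSeparates_oma_iff hα μ ν c).1 hc
  simp_rw [meijerIntegrand_oma_line hα hμ hρ hΩ]
  refine Integrable.const_mul (Integrable.comp_mul_left' ?_ (by norm_num : (-2 : ℝ) ≠ 0)) _
  exact Complex.integrable_mellinBarnes (by linarith) (omaScale_pos hμ hρ hΩ) (by linarith)
    (by linarith)

/-- Under σ = -2c the three separation conditions become 0 < σ, 0 < a-κσ and a-κσ < r, the
hypotheses of the Mellin-Barnes formula. The absence of c on the right is the independence of the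
line. -/
theorem meijerLineIntegral_oma (hα : 0 < α) (hμ : 0 < μ) (hρ : 0 < ρ) (hΩ : 0 < Ω)
    (hc : MeijerSeparates (2 + α) α (upperParams α μ) (lowerParams α μ ν) c) :
    meijerLineIntegral (2 + α) α (upperParams α μ) (lowerParams α μ ν) (gArg α μ ρ Ω) c =
      ((omaMeijerConst α ν / 2 * (Real.Gamma (ν / 2) * omaIntegral α μ ν ρ Ω) : ℝ) : ℂ) := by
  obtain ⟨h1, h2, h3⟩ := (meijerSeparates_oma_iff hα μ ν c).1 hc
  have hMB := Complex.integral_mellinBarnes (a := (α * μ : ℝ) / 2) (r := ν / 2) (κ := (α : ℝ) / 2)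
    (w := omaScale α μ ρ Ω) (σ := -2 * c) (by linarith) (omaScale_pos hμ hρ hΩ) (by linarith)
    (by linarith)
  rw [meijerLineIntegral, integral_mul_const]
  simp_rw [meijerIntegrand_oma_line hα hμ hρ hΩ]
  rw [integral_const_mul, Measure.integral_comp_mul_left (Complex.mellinBarnesIntegrand _ _ _ _ _), omaIntegral, Complex.ofReal_mul, ← hMB]
  have hpi : (Real.pi : ℂ) ≠ 0 := Complex.ofReal_ne_zero.2 Real.pi_ne_zero
  -- The substitution y ↦ -2y reverses the real line, so its Jacobian enters by absolute value.
  have hab : |((-2 : ℝ))⁻¹| = 1 / 2 := by norm_num [abs_of_neg]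
  rw [hab, Complex.real_smul]
  push_cast
  field_simp

theorem omaG_eq (hα : 0 < α) (hμ : 0 < μ) (hν : 0 < ν) (hρ : 0 < ρ) (hΩ : 0 < Ω) :
    omaG α μ ν ρ Ω =
      ((omaMeijerConst α ν / 2 * (Real.Gamma (ν / 2) * omaIntegral α μ ν ρ Ω) : ℝ) : ℂ) := by
  have h := exists_meijerSeparates_oma hα hμ hν
  rw [omaG, meijerG, dif_pos h]
  exact meijerLineIntegral_oma hα hμ hρ hΩ h.choose_spec

theorem meijerGWellDefined_oma (hα : 0 < α) (hμ : 0 < μ) (hν : 0 < ν) (hρ : 0 < ρ) (hΩ : 0 < Ω) :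
    MeijerGWellDefined (2 + α) α (upperParams α μ) (lowerParams α μ ν) (gArg α μ ρ Ω) :=
  ⟨exists_meijerSeparates_oma hα hμ hν, fun _ hc =>
    ⟨integrable_meijerIntegrand_oma hα hμ hρ hΩ hc,
      (meijerLineIntegral_oma hα hμ hρ hΩ hc).trans (omaG_eq hα hμ hν hρ hΩ).symm⟩⟩

/-! ### The expectation -/

theorem measurable_gainPDF : Measurable (gainPDF α μ Ω) := by
  unfold gainPDF
  refine Measurable.ite measurableSet_Ioi ?_ measurable_const
  fun_prop

theorem gainPDF_nonneg (hΩ : 0 < Ω) (x : ℝ) : 0 ≤ gainPDF α μ Ω x := by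
  unfold gainPDF
  split_ifs with hx
  · have := Real.Gamma_nonneg_of_nonneg (μ.cast_nonneg (α := ℝ))
    positivity
  · exact le_rfl

theorem integral_gainLaw (hΩ : 0 < Ω) (f : ℝ → ℝ) :
    ∫ x, f x ∂gainLaw α μ Ω = ∫ x in Set.Ioi (0 : ℝ), gainPDF α μ Ω x * f x := by
  rw [gainLaw, integral_withDensity_eq_integral_toReal_smul
    measurable_gainPDF.ennreal_ofReal (Filter.Eventually.of_forall fun _ => ENNReal.ofReal_lt_top)]
  simp_rw [ENNReal.toReal_ofReal (gainPDF_nonneg hΩ _), smul_eq_mul]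
  refine (setIntegral_eq_integral_of_forall_compl_eq_zero fun x hx => ?_).symm
  rw [gainPDF, if_neg (show ¬ 0 < x from hx), zero_mul]

theorem integral_gainPDF_mul_rpow (hρ : 0 < ρ) (hΩ : 0 < Ω) :
    ∫ x in Set.Ioi (0 : ℝ), gainPDF α μ Ω x * (1 + ρ * x) ^ (-(ν / 2)) =
      α * (μ : ℝ) ^ μ / (2 * Ω ^ (α * μ) * Real.Gamma μ * ρ ^ ((α * μ : ℝ) / 2)) *
        omaIntegral α μ ν ρ Ω := by
  have hsub := integral_comp_mul_left_Ioi (fun u : ℝ => u ^ ((α * μ : ℝ) / 2 - 1) *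
    (1 + u) ^ (-(ν / 2)) * Real.exp (-(omaScale α μ ρ Ω * u ^ ((α : ℝ) / 2)))) 0 hρ
  rw [mul_zero, smul_eq_mul, eq_inv_mul_iff_mul_eq₀ hρ.ne'] at hsub
  rw [omaIntegral, ← hsub, ← integral_const_mul, ← integral_const_mul]
  refine setIntegral_congr_fun measurableSet_Ioi fun x hx => ?_
  have hx' : 0 < x := hx
  have hρa : 0 < ρ ^ ((α * μ : ℝ) / 2) := by positivity
  have hρk : 0 < ρ ^ ((α : ℝ) / 2) := by positivity
  rw [gainPDF, if_pos hx', Real.mul_rpow hρ.le hx'.le, Real.mul_rpow hρ.le hx'.le,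
    Real.rpow_sub_one hρ.ne']
  have he : omaScale α μ ρ Ω * (ρ ^ ((α : ℝ) / 2) * x ^ ((α : ℝ) / 2)) =
      μ * x ^ ((α : ℝ) / 2) / Ω ^ α := by
    rw [omaScale]; field_simp
  rw [he]
  field_simp

end

/-! ### From the law of the gain to the effective rate -/

section

theorem gain_nonneg {S : Type*} (h : S → ℂ) (ω : S) : 0 ≤ gain h ω := sq_nonneg _

variable {S : Type*} [MeasurableSpace S] {P : Measure S} {α μ : ℕ} {ν ρ Ω : ℝ} {h : S → ℂ}

theorem integrable_rpow_gain [IsFiniteMeasure P] (hν : 0 < ν) (hρ : 0 < ρ)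
    (hm : AEMeasurable (gain h) P) :
    Integrable (fun ω => (1 + ρ * gain h ω) ^ (-(ν / 2))) P := by
  refine Integrable.of_bound (C := 1) ?_ (Filter.Eventually.of_forall fun ω => ?_)
  · exact (((hm.const_mul ρ).const_add 1).pow_const _).aestronglyMeasurable
  · have h0 : 0 ≤ ρ * gain h ω := mul_nonneg hρ.le (gain_nonneg h ω)
    rw [Real.norm_of_nonneg (by positivity)]
    exact Real.rpow_le_one_of_one_le_of_nonpos (by linarith) (by linarith)

theorem integral_rpow_gain_pos [IsProbabilityMeasure P] (hν : 0 < ν) (hρ : 0 < ρ)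
    (hm : AEMeasurable (gain h) P) : 0 < ∫ ω, (1 + ρ * gain h ω) ^ (-(ν / 2)) ∂P := by
  have hpos : ∀ ω, 0 < (1 + ρ * gain h ω) ^ (-(ν / 2)) := fun ω => by
    have h0 : 0 ≤ ρ * gain h ω := mul_nonneg hρ.le (gain_nonneg h ω)
    positivity
  rw [integral_pos_iff_support_of_nonneg (fun ω => (hpos ω).le) (integrable_rpow_gain hν hρ hm)]
  have hs : Function.support (fun ω => (1 + ρ * gain h ω) ^ (-(ν / 2))) = Set.univ :=
    Set.eq_univ_of_forall fun ω => (hpos ω).ne'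
  rw [hs, measure_univ]
  exact one_pos

theorem integral_rpow_gain_eq_omaClosedArg (hα : 0 < α) (hμ : 0 < μ) (hν : 0 < ν) (hρ : 0 < ρ)
    (hΩ : 0 < Ω) (law : HasLaw (gain h) (gainLaw α μ Ω) P) :
    ∫ ω, (1 + ρ * gain h ω) ^ (-(ν / 2)) ∂P = omaClosedArg α μ ν ρ Ω := by
  have hint := law.integral_comp (f := fun x : ℝ => (1 + ρ * x) ^ (-(ν / 2)))
    (by fun_prop : Measurable fun x : ℝ => (1 + ρ * x) ^ (-(ν / 2))).aestronglyMeasurable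
  simp only [Function.comp_def] at hint
  have hα' : (0 : ℝ) < α := Nat.cast_pos.2 hα
  have hμ' : (0 : ℝ) < μ := Nat.cast_pos.2 hμ
  have hΓμ := Real.Gamma_pos_of_pos hμ'
  have hΓν := Real.Gamma_pos_of_pos (half_pos hν)
  have hρa : 0 < ρ ^ ((α * μ : ℝ) / 2) := by positivity
  have hpi := Real.pi_pos
  -- The constants match because √2 (2π)^(α-1/2) = 2√π (2π)^(α-1) and α^(ν/2) α^(1-ν/2) = α.
  have e1 : (2 * Real.pi) ^ ((α : ℝ) - 1 / 2) = (2 * Real.pi) ^ (α - 1) * (√2 * √Real.pi) := by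
    rw [← Real.sqrt_mul (by norm_num), Real.sqrt_eq_rpow, ← Real.rpow_natCast, ← Real.rpow_add
      (by positivity), Nat.cast_sub hα]
    congr 1
    push_cast
    ring
  have e2 : (α : ℝ) ^ (1 - ν / 2) = α / (α : ℝ) ^ (ν / 2) := by
    rw [Real.rpow_sub hα', Real.rpow_one]
  have hp : 0 < (α : ℝ) ^ (ν / 2) := by positivity
  have h2 : √(2 : ℝ) ^ 2 = 2 := Real.sq_sqrt (by norm_num)
  rw [hint, integral_gainLaw hΩ, integral_gainPDF_mul_rpow hρ hΩ, omaClosedArg,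
    omaG_eq hα hμ hν hρ hΩ, Complex.ofReal_re, omaMeijerConst, e1, e2]
  field_simp
  rw [h2, mul_comm]

theorem omaRate_eq_omaClosedForm_of_hasLaw [IsProbabilityMeasure P] (hα : 0 < α) (hμ : 0 < μ)
    (hν : 0 < ν) (hρ : 0 < ρ) (hΩ : 0 < Ω) (law : HasLaw (gain h) (gainLaw α μ Ω) P) :
    Integrable (fun ω => (1 + ρ * gain h ω) ^ (-(ν / 2))) P ∧
      OmaClosedFormMeaningful α μ ν ρ Ω ∧ omaRate P ν ρ h = omaClosedForm α μ ν ρ Ω := by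
  have heq := integral_rpow_gain_eq_omaClosedArg hα hμ hν hρ hΩ law
  refine ⟨integrable_rpow_gain hν hρ law.aemeasurable,
    ⟨meijerGWellDefined_oma hα hμ hν hρ hΩ, ?_, ?_⟩, ?_⟩
  · rw [omaG_eq hα hμ hν hρ hΩ, Complex.ofReal_im]
  -- Positivity is read off from the expectation of a positive variable, not from the G-function.
  · rw [← heq]
    exact integral_rpow_gain_pos hν hρ law.aemeasurable
  · rw [omaRate, omaClosedForm, heq]

end

theorem mainTheorem7 {S : Type*} [MeasurableSpace S] (P : Measure S) [IsProbabilityMeasure P]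
    (α μ : ℕ) (hα : 0 < α) (hμ : 0 < μ)
    (ν ρ Ωs Ωw : ℝ) (hν : 0 < ν) (hρ : 0 < ρ) (hΩs : 0 < Ωs) (hΩw : 0 < Ωw)
    (hs hw : S → ℂ)
    (law_s : HasLaw (gain hs) (gainLaw α μ Ωs) P)
    (law_w : HasLaw (gain hw) (gainLaw α μ Ωw) P) :
    (Integrable (fun ω => (1 + ρ * gain hs ω) ^ (-(ν / 2))) P ∧
      OmaClosedFormMeaningful α μ ν ρ Ωs ∧
      omaRate P ν ρ hs = omaClosedForm α μ ν ρ Ωs) ∧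
    (Integrable (fun ω => (1 + ρ * gain hw ω) ^ (-(ν / 2))) P ∧
      OmaClosedFormMeaningful α μ ν ρ Ωw ∧
      omaRate P ν ρ hw = omaClosedForm α μ ν ρ Ωw) ∧
    omaSumRate P ν ρ hs hw = omaClosedForm α μ ν ρ Ωs + omaClosedForm α μ ν ρ Ωw := by
  have h1 := omaRate_eq_omaClosedForm_of_hasLaw hα hμ hν hρ hΩs law_s
  have h2 := omaRate_eq_omaClosedForm_of_hasLaw hα hμ hν hρ hΩw law_w
  exact ⟨h1, h2, by rw [omaSumRate, h1.2.2, h2.2.2]⟩
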